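/- **Setting.** Let $X$ solve $dX_t=b(X_t)\,dt+\sum_{j=1}^q\sigma_j(X_t)\,dW^j_t$, $X_0=x_0\in\mathbb R^d$, on $[0,T]$, $T>0$, where $W$ is a $q$-dimensional Brownian motion and $b,\sigma_j:\mathbb R^d\to\mathbb R^d$ are Lipschitz; let $P:\mathbb R^d\to\mathbb R$ be measurable. Let $\mathbf h=T/N_0$ with an integer $N_0\ge1$, and for $h=\mathbf h/n$, $n\ge 1$, let $X^h$ be the approximation of $X$ by a fixed one-step discretization scheme with step $h$: $X^h_{(k+1)h}$ is a measurable function, depending only on $h$, of $X^h_{kh}$ and of the increments $(W_{kh+s}-W_{kh})_{0\le s\le h}$ (for example the Euler or the Milstein scheme). Fix a refinement factor $M\ge2$, a number of levels $L\ge1$, rates $\alpha,\beta>0$ and $V_1>0$. Put $$Z_1=P(X_T^{\mathbf h}),\qquad Z_l=P(X_T^{\mathbf h/M^{l-1}})-P(X_T^{\mathbf h/M^{l-2}})\quad(l\ge2),$$ $$Y_1=Z_1,\qquad Y_l=(\mathbf h/M^{l-1})^{-\beta/2}Z_l\quad(l\ge2).$$ Let $(w_j)_{1\le j\le L}$ solve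 $\sum_{j=1}^L M^{-\alpha i(j-1)}w_j=\mathbf 1_{\{i=0\}}$, $0\le i<L$, and put $\widetilde W_l=\sum_{j=l}^Lw_j$. For $\beta>1$ let $\lambda=\sqrt{V_1/\mathrm{Var}(P(X_T))}$, $\underline C=(1+M^{\beta/2})/\sqrt{1+M^{-1}}$, $\overline C=(1+M^{\beta/2})\sqrt{1+M^{-1}}$, $$\Sigma=1+\lambda\mathbf h^{\beta/2}\Bigl(1+\overline C\,\frac{M^{(1-\beta)/2}}{1-M^{(1-\beta)/2}}\Bigr),\qquad k_1=\frac1{\Sigma\,\mathrm{Var}(P(X_T))\,(1+\lambda\mathbf h^{\beta/2})},$$ $$k_l=\frac{\mathbf h^{\beta/2}}{\Sigma\sqrt{\mathrm{Var}(P(X_T))V_1}\;\underline C}\,M^{\frac{1+\beta}2(l-1)}\,|\widetilde W_l|\,\mathbf h^{-\beta}\quad(2\le l\le L).$$ Put $Q_l=k_lZ_l^2$ if $\beta>1$ and $Q_l=Y_l^2$ if $\beta\le1$, $\mathcal J^+(x,\theta)=e^{-\langle x,\theta\rangle+\frac12|\theta|^2T}$, and $$\mathbf v_l(\theta)=\mathbb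 E\bigl[Q_l\,\mathcal J^+(W_T,\theta)\bigr],\qquad G_l(\theta)=(\theta T-W_T)\,Q_l\,\mathcal J^+(W_T,\theta),\qquad\theta\in\mathbb R^q.$$ **Assumptions.** Fix $l\in\{1,\dots,L\}$. (i) The strong error bound $\mathbb E|P(X_T^h)-P(X_T)|^r\le V^{(r)}h^{\beta r/2}$ for all $h=\mathbf h/n$, $n\ge1$, holds for $r=2$ with $V^{(2)}=V_1$, and for $r=p$ with some $p>4$ and some constant $V^{(p)}>0$. (ii) If $l=1$, then $\mathbb E|Z_1|^p<\infty$. (iii) $\mathbb P(Z_l\ne0)>0$. (iv) If $\beta>1$, then $\mathbb E|P(X_T)|^2<\infty$ and $\mathrm{Var}(P(X_T))>0$, and, if moreover $l\ge2$, $\widetilde W_l\neq0$. **Algorithm.** Let $\Theta\subset\mathbb R^q$ be compact and convex and $\theta_l^0\in\Theta$. Let $(\gamma_n)_{n\ge1}$ be a non-increasing sequence of positive reals with $\sum\gamma_n=\infty$ and $\sum\gamma_n^2<\infty$, and let $W^{(1)},W^{(2)},\dots$ be independent copies of $W$. With $G_l^{(n)}(\theta)$ denoting $G_l(\theta)$ computed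 from the path $W^{(n)}$ in place of $W$, and $\mathrm{Proj}_\Theta$ the nearest-point projection onto $\Theta$, define $$\theta_l^{n+1}=\mathrm{Proj}_\Theta\bigl[\theta_l^n-\gamma_{n+1}G_l^{(n+1)}(\theta_l^n)\bigr],\qquad n\ge0.$$ **Theorem.** If $\theta_l^*$ minimizes $\mathbf v_l$ over $\mathbb R^q$, $\nabla\mathbf v_l(\theta_l^*)=0$ and $\theta_l^*\in\Theta$, then $\theta_l^k\to\theta_l^*$ almost surely as $k\to\infty$. -/

import Mathlib

open MeasureTheory ProbabilityTheory Filter Topology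
open scoped NNReal ENNReal

namespace ML2R

/-- `ℝⁿ` with the Euclidean norm. -/
abbrev E (n : ℕ) : Type := EuclideanSpace ℝ (Fin n)

/-! ### Brownian motion and the stochastic differential equation -/

/-- `B` is a standard `q`-dimensional Brownian motion with respect to the filtration `ℱ`. -/
structure IsBrownianMotion {Ω : Type*} {m : MeasurableSpace Ω} {q : ℕ} (μ : Measure Ω)
    (ℱ : Filtration ℝ≥0 m) (B : ℝ≥0 → Ω → E q) : Prop where
  adapted : StronglyAdapted ℱ B
  start : ∀ᵐ ω ∂μ, B 0 ω = 0
  indep : ∀ s t : ℝ≥0, s ≤ t →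
    Indep (ℱ s) (MeasurableSpace.comap (fun ω => B t ω - B s ω) inferInstance) μ
  law : ∀ s t : ℝ≥0, s ≤ t →
    μ.map (fun ω => B t ω - B s ω) =
      (stdGaussian (E q)).map (fun z => Real.sqrt ((t : ℝ) - s) • z)
  cont : ∀ᵐ ω ∂μ, Continuous (fun t => B t ω)

/-- The matrix-vector product `σ(x) y = ∑ⱼ yⱼ σⱼ(x)`, where the `σⱼ` are the columns of `σ`. -/
noncomputable def diffusionApply {d q : ℕ} (σ : Fin q → E d → E d) (x : E d) (y : E q) : E d :=
  ∑ j, y j • σ j x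

/-- `I` is the Itô integral `∑ⱼ ∫₀ᵗ σⱼ(X_s) dBʲ_s` of the continuous adapted process `σ(X)`:
the limit in probability of the left-point Riemann sums over the uniform partitions of `[0, t]`. -/
def IsItoIntegral {Ω : Type*} {m : MeasurableSpace Ω} {d q : ℕ} (μ : Measure Ω)
    (σ : Fin q → E d → E d) (X : ℝ≥0 → Ω → E d) (B : ℝ≥0 → Ω → E q) (t : ℝ≥0)
    (I : Ω → E d) : Prop :=
  TendstoInMeasure μ
    (fun (n : ℕ) ω => ∑ i ∈ Finset.range n,
      diffusionApply σ (X (t * i / n) ω) (B (t * (i + 1) / n) ω - B (t * i / n) ω))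
    atTop I

/-- `X` is a solution on `[0, T]` of `dX = b(X) dt + ∑ⱼ σⱼ(X) dBʲ`, `X₀ = x₀`. -/
structure IsSDESolution {Ω : Type*} {m : MeasurableSpace Ω} {d q : ℕ} (μ : Measure Ω)
    (ℱ : Filtration ℝ≥0 m) (b : E d → E d) (σ : Fin q → E d → E d) (x₀ : E d) (T : ℝ≥0)
    (B : ℝ≥0 → Ω → E q) (X : ℝ≥0 → Ω → E d) : Prop where
  adapted : StronglyAdapted ℱ X
  cont : ∀ᵐ ω ∂μ, Continuous (fun t => X t ω)
  eqn : ∀ t : ℝ≥0, t ≤ T → IsItoIntegral μ σ X B t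
    (fun ω => X t ω - x₀ - ∫ s in (0 : ℝ)..t, b (X s.toNNReal ω))

/-! ### The multilevel setting -/

/-- The data: coefficients `b, σⱼ` and initial value `x₀` of the equation, horizon `T`,
payoff `P`, one-step map `step` of the discretization scheme, refinement factor `M`,
number `N₀` of time steps on the coarsest level (so `𝐡 = T / N₀`), number of levels `L`,
weak and strong error rates `α`, `β`, and strong error constant `V₁`.

`step h x w` is the value after one time step of length `h` from the state `x`, when the driving
Brownian path over that step has the increments `w s`, `0 ≤ s ≤ h`, since the start of the step.
Euler's scheme is `step h x w = x + h b(x) + σ(x) w(h)`; Milstein's scheme adds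
`∑ᵢⱼ Dσⱼ(x)[σᵢ(x)] ∫₀ʰ wᵢ dwʲ`, which is `σ'(x) σ(x) (w(h)² - h) / 2` in dimension one. -/
structure Setting (d q : ℕ) where
  b : E d → E d
  σ : Fin q → E d → E d
  x₀ : E d
  T : ℝ≥0
  P : E d → ℝ
  step : ℝ≥0 → E d → (ℝ≥0 → E q) → E d
  M : ℕ
  N₀ : ℕ
  L : ℕ
  α : ℝ
  β : ℝ
  V₁ : ℝ

namespace Setting

variable {d q : ℕ} (A : Setting d q)

/-- Standing assumptions on the data. -/
structure Admissible : Prop where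
  lipschitz : ∃ K : ℝ, 0 < K ∧ ∀ x y : E d,
    ‖A.b x - A.b y‖ + ∑ j, ‖A.σ j x - A.σ j y‖ ≤ K * ‖x - y‖
  T_pos : 0 < A.T
  P_meas : Measurable A.P
  step_meas : ∀ h : ℝ≥0, Measurable (fun z : E d × (ℝ≥0 → E q) => A.step h z.1 z.2)
  two_le_M : 2 ≤ A.M
  N₀_pos : 0 < A.N₀
  α_pos : 0 < A.α
  β_pos : 0 < A.β
  V₁_pos : 0 < A.V₁

/-- The coarsest step size `𝐡`. -/
noncomputable def bigh : ℝ := (A.T : ℝ) / A.N₀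

/-- The state of the scheme with step size `h` after `k` steps, driven by the path `w`. -/
def state (h : ℝ≥0) (w : ℝ≥0 → E q) : ℕ → E d
  | 0 => A.x₀
  | k + 1 => A.step h (state h w k) (fun s => w (k * h + min s h) - w (k * h))

/-- `P(X_T^{𝐡/n})`: the payoff of the scheme with step size `𝐡 / n`, i.e. with `N₀ n` steps
on `[0, T]`, driven by the path `w`. -/
noncomputable def approxPayoff (n : ℕ) (w : ℝ≥0 → E q) : ℝ :=
  A.P (A.state (A.T / ((A.N₀ * n : ℕ) : ℝ≥0)) w (A.N₀ * n))

/-- `Z₁ = P(X_T^𝐡)` and `Z_l = P(X_T^{𝐡/M^{l-1}}) - P(X_T^{𝐡/M^{l-2}})` for `l ≥ 2`. -/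
noncomputable def Z (l : ℕ) (w : ℝ≥0 → E q) : ℝ :=
  if l = 1 then A.approxPayoff 1 w
  else A.approxPayoff (A.M ^ (l - 1)) w - A.approxPayoff (A.M ^ (l - 2)) w

/-- `Y₁ = Z₁` and `Y_l = (𝐡/M^{l-1})^{-β/2} Z_l` for `l ≥ 2`. -/
noncomputable def Y (l : ℕ) (w : ℝ≥0 → E q) : ℝ :=
  if l = 1 then A.Z 1 w
  else (A.bigh / (A.M : ℝ) ^ (l - 1)) ^ (-A.β / 2) * A.Z l w

/-- The Vandermonde matrix with rows `n_1^{-α i}, …, n_L^{-α i}` (`0 ≤ i < L`), `n_j = M^{j-1}`. -/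
noncomputable def vander : Matrix (Fin A.L) (Fin A.L) ℝ :=
  fun i j => ((A.M : ℝ) ^ (j : ℕ)) ^ (-(A.α * (i : ℕ)))

/-- The solution `w` of `V w = e₁`. -/
noncomputable def smallw : Fin A.L → ℝ :=
  A.vander⁻¹.mulVec (fun i => if (i : ℕ) = 0 then 1 else 0)

/-- The weight `W̃_l = ∑_{j = l}^{L} w_j` (the index `j` here counts from zero). -/
noncomputable def bigW (l : ℕ) : ℝ :=
  ∑ j : Fin A.L, if l ≤ (j : ℕ) + 1 then A.smallw j else 0

/-- `λ = √(V₁ / Var P(X_T))`; `varP` stands for `Var P(X_T)`, here and below. -/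
noncomputable def lam (varP : ℝ) : ℝ := Real.sqrt (A.V₁ / varP)

noncomputable def CLow : ℝ :=
  (1 + (A.M : ℝ) ^ (A.β / 2)) / Real.sqrt (1 + (A.M : ℝ)⁻¹)

noncomputable def CUp : ℝ :=
  (1 + (A.M : ℝ) ^ (A.β / 2)) * Real.sqrt (1 + (A.M : ℝ)⁻¹)

/-- The constant `Σ` of the central limit theorem for `β > 1`. -/
noncomputable def bigSigma (varP : ℝ) : ℝ :=
  1 + A.lam varP * A.bigh ^ (A.β / 2) *
    (1 + A.CUp * ((A.M : ℝ) ^ ((1 - A.β) / 2) / (1 - (A.M : ℝ) ^ ((1 - A.β) / 2))))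

/-- The coefficient at level one, for `β > 1`. -/
noncomputable def kOne (varP : ℝ) : ℝ :=
  1 / A.bigSigma varP * (1 / (varP * (1 + A.lam varP * A.bigh ^ (A.β / 2))))

/-- The level-independent factor of the coefficients at the levels `l ≥ 2`, for `β > 1`. -/
noncomputable def kTwo (varP : ℝ) : ℝ :=
  A.bigh ^ (A.β / 2) / (A.bigSigma varP * Real.sqrt (varP * A.V₁) * A.CLow)

/-- The coefficient `k_l` at level `l`, for `β > 1`. -/
noncomputable def k (varP : ℝ) (l : ℕ) : ℝ :=
  if l = 1 then A.kOne varP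
  else A.kTwo varP * (A.M : ℝ) ^ ((1 + A.β) / 2 * ((l : ℝ) - 1)) * |A.bigW l| * A.bigh ^ (-A.β)

/-- `k_l Z_l²` if `β > 1`, and `Y_l²` if `β ≤ 1`. -/
noncomputable def weightedSq (varP : ℝ) (l : ℕ) (w : ℝ≥0 → E q) : ℝ :=
  if 1 < A.β then A.k varP l * A.Z l w ^ 2 else A.Y l w ^ 2

/-- `J⁺(w_T, θ) = exp(-⟨θ, w_T⟩ + |θ|² T / 2)`. -/
noncomputable def Jplus (x θ : E q) : ℝ :=
  Real.exp (-(inner ℝ θ x) + 1 / 2 * ‖θ‖ ^ 2 * A.T)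

/-- The level-`l` variance functional `v_l(θ)`; `B` is the driving Brownian motion. -/
noncomputable def v {Ω : Type*} {m : MeasurableSpace Ω} (μ : Measure Ω) (B : ℝ≥0 → Ω → E q)
    (varP : ℝ) (l : ℕ) (θ : E q) : ℝ :=
  ∫ ω, A.weightedSq varP l (fun t => B t ω) * A.Jplus (B A.T ω) θ ∂μ

/-- The gradient estimator `G_l` at `θ`, computed from the Brownian path `w`. -/
noncomputable def G (varP : ℝ) (l : ℕ) (θ : E q) (w : ℝ≥0 → E q) : E q :=
  (A.weightedSq varP l w * A.Jplus (w A.T) θ) • ((A.T : ℝ) • θ - w A.T)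

/-- The `Lᵖ`-strong error assumption with rate `β` and constant `V`:
`E|P(X_T^h) - P(X_T)|ᵖ ≤ V h^{βp/2}` for all `h = 𝐡/n`, `n ≥ 1`. -/
def StrongError {Ω : Type*} {m : MeasurableSpace Ω} (μ : Measure Ω) (B : ℝ≥0 → Ω → E q)
    (XT : Ω → E d) (p V : ℝ) : Prop :=
  ∀ n : ℕ, 1 ≤ n →
    ∫⁻ ω, ENNReal.ofReal (|A.approxPayoff n (fun t => B t ω) - A.P (XT ω)| ^ p) ∂μ ≤
      ENNReal.ofReal (V * (A.bigh / n) ^ (A.β * p / 2))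

end Setting

/-- `y` is the projection of `x` onto `Θ`: the nearest point of `Θ` (unique if `Θ` is convex). -/
def IsProj {q : ℕ} (Θ : Set (E q)) (x y : E q) : Prop :=
  y ∈ Θ ∧ ∀ z ∈ Θ, ‖x - y‖ ≤ ‖x - z‖

end ML2R

/-!
The weight `J⁺(x, θ)` is the exponential of a quadratic polynomial in `θ`, so `eᵗ ≥ 1 + t` gives
`J⁺(x, θ') ≥ J⁺(x, θ) (1 + T/2 ‖θ' - θ‖²) + ⟪θ' - θ, ∇J⁺(x, θ)⟫`. Taking expectations against `Q_l`,
with `θ'` the minimiser `θ*` of `v_l`, and using `v_l(θ) ≥ v_l(θ*)` shows that the mean field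
satisfies `⟪θ - θ*, E[G_l(θ)]⟫ ≥ T/2 v_l(θ*) ‖θ - θ*‖²`, where `v_l(θ*) > 0` because `Z_l` is
nondegenerate. As `p > 4`, Hölder's inequality and the exponential moments of Gaussian vectors bound
`E‖G_l(θ)‖²` uniformly over `Θ`. Since the projection is nonexpansive and fixes `θ*`, the
conditional mean of `‖θⁿ⁺¹ - θ*‖²` is at most `(1 - 2cγ) ‖θⁿ - θ*‖² + Kγ²`, with
`c = T/2 v_l(θ*)`. By the supermartingale convergence theorem `‖θⁿ - θ*‖²` converges almost surely,
and `∑ γ = ∞` leaves `0` as the only possible limit.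
-/

namespace ML2R

section Projection

variable {q : ℕ} {Θ : Set (E q)} {x y x' y' z : E q}

theorem isProj_iff_norm_sub_eq_iInf : IsProj Θ x y ↔ y ∈ Θ ∧ ‖x - y‖ = ⨅ w : Θ, ‖x - w‖ := by
  have hbdd : BddBelow (Set.range fun w : Θ => ‖x - w‖) :=
    ⟨0, Set.forall_mem_range.2 fun w => norm_nonneg _⟩
  refine and_congr_right fun hy => ⟨fun h => ?_, fun h w hw => h.trans_le (ciInf_le hbdd ⟨w, hw⟩)⟩
  have : Nonempty Θ := ⟨⟨y, hy⟩⟩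
  exact le_antisymm (le_ciInf fun w => h w w.2) (ciInf_le hbdd ⟨y, hy⟩)

theorem isProj_self (hx : x ∈ Θ) : IsProj Θ x x :=
  ⟨hx, fun w _ => by simp only [sub_self, norm_zero, norm_nonneg]⟩

theorem IsProj.inner_sub_sub_nonpos (hΘ : Convex ℝ Θ) (h : IsProj Θ x y) (hz : z ∈ Θ) :
    inner ℝ (x - y) (z - y) ≤ 0 :=
  (norm_eq_iInf_iff_real_inner_le_zero hΘ h.1).1 (isProj_iff_norm_sub_eq_iInf.1 h).2 z hz

theorem IsProj.norm_sub_le_norm_sub (hΘ : Convex ℝ Θ) (h : IsProj Θ x y) (h' : IsProj Θ x' y') :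
    ‖y - y'‖ ≤ ‖x - x'‖ := by
  have hinner : ‖y - y'‖ * ‖y - y'‖ ≤ ‖x - x'‖ * ‖y - y'‖ := by
    have hy := h.inner_sub_sub_nonpos hΘ h'.1
    have hy' := h'.inner_sub_sub_nonpos hΘ h.1
    refine le_trans ?_ (real_inner_le_norm (x - x') (y - y'))
    rw [← real_inner_self_eq_norm_mul_norm]
    simp only [inner_sub_left, inner_sub_right] at *
    linarith
  rcases (norm_nonneg (y - y')).eq_or_lt with h0 | hpos
  · exact h0 ▸ norm_nonneg _
  · exact le_of_mul_le_mul_right hinner hpos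

theorem exists_lipschitzWith_forall_isProj (hc : IsClosed Θ) (hΘ : Convex ℝ Θ)
    (hne : Θ.Nonempty) :
    ∃ π : E q → E q, LipschitzWith 1 π ∧ ∀ x y, IsProj Θ x y → y = π x := by
  choose π hπΘ hπ using exists_norm_eq_iInf_of_complete_convex hne hc.isComplete hΘ
  have hproj x : IsProj Θ x (π x) := isProj_iff_norm_sub_eq_iInf.2 ⟨hπΘ x, hπ x⟩
  refine ⟨π, LipschitzWith.of_dist_le_mul fun x y => ?_, fun x y hy => ?_⟩
  · simpa only [dist_eq_norm, NNReal.coe_one, one_mul] using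
      (hproj x).norm_sub_le_norm_sub hΘ (hproj y)
  · simpa only [sub_self, norm_zero, norm_le_zero_iff, sub_eq_zero] using
      hy.norm_sub_le_norm_sub hΘ (hproj x)

end Projection

section Freezing

variable {Ω R S F : Type*} {m mΩ : MeasurableSpace Ω} [MeasurableSpace R] [mS : MeasurableSpace S]
  {μ : Measure Ω} [IsProbabilityMeasure μ] {X : Ω → R} {W : Ω → S} [NormedAddCommGroup F]
  {f : R × S → F}

theorem map_restrict_prodMk_eq_prod_of_indep (hm : m ≤ mΩ) (hX : Measurable[m] X)
    (hW : Measurable W) (hind : Indep m (mS.comap W) μ) {A : Set Ω} (hA : MeasurableSet[m] A) :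
    (μ.restrict A).map (fun ω => (X ω, W ω)) = ((μ.restrict A).map X).prod (μ.map W) := by
  have hXm : Measurable X := hX.mono hm le_rfl
  refine (Measure.prod_eq fun s t hs ht => ?_).symm
  rw [Measure.map_apply (hXm.prodMk hW) (hs.prod ht), Measure.map_apply hXm hs,
    Measure.map_apply hW ht, Set.mk_preimage_prod,
    Measure.restrict_apply ((hXm hs).inter (hW ht)), Measure.restrict_apply (hXm hs),
    ← Indep_iff .. |>.1 hind _ _ ((hX hs).inter hA) ⟨t, ht, rfl⟩, Set.inter_right_comm]

theorem integrable_comp_prodMk_of_indep (hm : m ≤ mΩ) (hX : Measurable[m] X) (hW : Measurable W)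
    (hind : Indep m (mS.comap W) μ) (hf : StronglyMeasurable f)
    (hfX : ∀ ω, Integrable (fun w => f (X ω, w)) (μ.map W))
    (hfnorm : Integrable (fun ω => ∫ w, ‖f (X ω, w)‖ ∂(μ.map W)) μ) :
    Integrable (fun ω => f (X ω, W ω)) μ := by
  have : IsProbabilityMeasure (μ.map W) := Measure.isProbabilityMeasure_map hW.aemeasurable
  have hXm : Measurable X := hX.mono hm le_rfl
  have hmap := map_restrict_prodMk_eq_prod_of_indep hm hX hW hind MeasurableSet.univ
  rw [Measure.restrict_univ] at hmap
  refine Integrable.comp_measurable (g := f) ?_ (hXm.prodMk hW)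
  rw [hmap, integrable_prod_iff hf.aestronglyMeasurable]
  refine ⟨?_, ?_⟩
  · refine (ae_map_iff hXm.aemeasurable ?_).2 (ae_of_all _ hfX)
    exact measurableSet_integrable hf
  · exact (integrable_map_measure hf.norm.integral_prod_right'.aestronglyMeasurable
      hXm.aemeasurable).2 hfnorm

theorem condExp_comp_prodMk_of_indep [NormedSpace ℝ F] [CompleteSpace F] (hm : m ≤ mΩ)
    (hX : Measurable[m] X) (hW : Measurable W) (hind : Indep m (mS.comap W) μ)
    (hf : StronglyMeasurable f) (hfint : Integrable (fun ω => f (X ω, W ω)) μ) :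
    μ[fun ω => f (X ω, W ω) | m] =ᵐ[μ] fun ω => ∫ w, f (X ω, w) ∂(μ.map W) := by
  have : IsProbabilityMeasure (μ.map W) := Measure.isProbabilityMeasure_map hW.aemeasurable
  have hXm : Measurable X := hX.mono hm le_rfl
  have hXW : Measurable fun ω => (X ω, W ω) := hXm.prodMk hW
  have hsection : StronglyMeasurable fun x => ∫ w, f (x, w) ∂(μ.map W) :=
    hf.integral_prod_right'
  have hprod {A : Set Ω} (hA : MeasurableSet[m] A) :
      Integrable f (((μ.restrict A).map X).prod (μ.map W)) := by
    rw [← map_restrict_prodMk_eq_prod_of_indep hm hX hW hind hA]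
    exact (integrable_map_measure hf.aestronglyMeasurable hXW.aemeasurable).2 hfint.integrableOn
  refine (ae_eq_condExp_of_forall_setIntegral_eq hm hfint (fun A hA _ => ?_) (fun A hA _ => ?_)
    (hsection.comp_measurable hX).aestronglyMeasurable).symm
  · exact (hprod hA).integral_prod_left.comp_measurable hXm
  · refine (integral_map (μ := μ.restrict A) hXm.aemeasurable
      hsection.aestronglyMeasurable).symm.trans ?_
    rw [← integral_prod f (hprod hA), ← map_restrict_prodMk_eq_prod_of_indep hm hX hW hind hA,
      integral_map hXW.aemeasurable hf.aestronglyMeasurable]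

end Freezing

section AlmostSupermartingale

theorem eq_zero_of_tendsto_of_summable_mul {γ a : ℕ → ℝ} {x : ℝ} (hγ : ¬ Summable γ)
    (hγa : Summable fun n => γ n * a n) (ha : Tendsto a atTop (𝓝 x)) : x = 0 := by
  by_contra hx
  have hinv : (fun n => γ n * a n * (a n)⁻¹) =O[atTop] fun n => γ n * a n := by
    simpa only [mul_one] using
      (Asymptotics.isBigO_refl _ _).mul ((ha.inv₀ hx).isBigO_one ℝ)
  refine hγ (summable_of_isBigO_nat hγa (hinv.congr' ?_ EventuallyEq.rfl))
  filter_upwards [ha.eventually_ne hx] with n hn using mul_inv_cancel_right₀ hn _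

section Deterministic

variable {x γ ε : ℕ → ℝ}

theorem add_sum_mul_le_add_tsum (hstep : ∀ n, x (n + 1) ≤ (1 - γ n) * x n + ε n)
    (hε : ∀ n, 0 ≤ ε n) (hεsum : Summable ε) (n : ℕ) :
    x n + ∑ k ∈ Finset.range n, γ k * x k ≤ x 0 + ∑' k, ε k := by
  have hsum : x n + ∑ k ∈ Finset.range n, γ k * x k ≤ x 0 + ∑ k ∈ Finset.range n, ε k := by
    induction n with
    | zero => simp
    | succ n ih =>
      rw [Finset.sum_range_succ, Finset.sum_range_succ]
      linarith [hstep n]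
  linarith [hεsum.sum_le_tsum (Finset.range n) fun k _ => hε k]

theorem le_add_tsum_of_succ_le (hx : ∀ n, 0 ≤ x n) (hγ : ∀ n, 0 ≤ γ n)
    (hstep : ∀ n, x (n + 1) ≤ (1 - γ n) * x n + ε n) (hε : ∀ n, 0 ≤ ε n) (hεsum : Summable ε)
    (n : ℕ) : x n ≤ x 0 + ∑' k, ε k := by
  have hsum : 0 ≤ ∑ k ∈ Finset.range n, γ k * x k :=
    Finset.sum_nonneg fun k _ => mul_nonneg (hγ k) (hx k)
  linarith [add_sum_mul_le_add_tsum hstep hε hεsum n]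

theorem summable_mul_of_succ_le (hx : ∀ n, 0 ≤ x n) (hγ : ∀ n, 0 ≤ γ n)
    (hstep : ∀ n, x (n + 1) ≤ (1 - γ n) * x n + ε n) (hε : ∀ n, 0 ≤ ε n)
    (hεsum : Summable ε) : Summable fun n => γ n * x n :=
  summable_of_sum_range_le (c := x 0 + ∑' k, ε k) (fun n => mul_nonneg (hγ n) (hx n)) fun n => by
    linarith [add_sum_mul_le_add_tsum hstep hε hεsum n, hx n]

end Deterministic

variable {Ω : Type*} {mΩ : MeasurableSpace Ω} {μ : Measure Ω}

theorem ae_summable_of_summable_integral {f : ℕ → Ω → ℝ} (hf : ∀ n, Integrable (f n) μ)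
    (hf0 : ∀ n ω, 0 ≤ f n ω) (hsum : Summable fun n => ∫ ω, f n ω ∂μ) :
    ∀ᵐ ω ∂μ, Summable fun n => f n ω := by
  have hnorm n : eLpNorm (f n) 1 μ = ENNReal.ofReal (∫ ω, f n ω ∂μ) := by
    rw [eLpNorm_one_eq_lintegral_enorm, ← ofReal_integral_norm_eq_lintegral_enorm (hf n)]
    simp only [Real.norm_of_nonneg (hf0 n _)]
  have htsum : ∑' n, eLpNorm (f n) 1 μ ≠ ∞ := by
    simpa only [hnorm] using hsum.tsum_ofReal_ne_top
  filter_upwards [summable_norm_of_tsum_eLpNorm_ne_top le_rfl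
    (fun n => (hf n).aestronglyMeasurable) htsum] with ω hω using hω.of_norm

variable [IsProbabilityMeasure μ] {ℱ : Filtration ℕ mΩ} {a : ℕ → Ω → ℝ} {γ ε : ℕ → ℝ}

theorem integral_succ_le_of_condExp_succ_le (hint : ∀ n, Integrable (a n) μ)
    (hstep : ∀ n, μ[a (n + 1) | ℱ n] ≤ᵐ[μ] fun ω => (1 - γ n) * a n ω + ε n) (n : ℕ) :
    ∫ ω, a (n + 1) ω ∂μ ≤ (1 - γ n) * ∫ ω, a n ω ∂μ + ε n := by
  have hmul : Integrable (fun ω => (1 - γ n) * a n ω) μ := (hint n).const_mul _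
  calc ∫ ω, a (n + 1) ω ∂μ = ∫ ω, (μ[a (n + 1) | ℱ n]) ω ∂μ := (integral_condExp (ℱ.le n)).symm
    _ ≤ ∫ ω, ((1 - γ n) * a n ω + ε n) ∂μ :=
      integral_mono_ae integrable_condExp (hmul.add (integrable_const _)) (hstep n)
    _ = (1 - γ n) * ∫ ω, a n ω ∂μ + ε n := by
      rw [integral_add hmul (integrable_const _), integral_const_mul, integral_const,
        probReal_univ, one_smul]

theorem supermartingale_sub_sum_of_condExp_succ_le (ha : StronglyAdapted ℱ a)
    (hint : ∀ n, Integrable (a n) μ)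
    (hstep : ∀ n, μ[a (n + 1) | ℱ n] ≤ᵐ[μ] fun ω => a n ω + ε n) :
    Supermartingale (fun n ω => a n ω - ∑ k ∈ Finset.range n, ε k) ℱ μ := by
  refine supermartingale_nat (fun n => (ha n).sub stronglyMeasurable_const)
    (fun n => (hint n).sub (integrable_const _)) fun n => ?_
  filter_upwards [condExp_sub (hint (n + 1))
    (integrable_const (∑ k ∈ Finset.range (n + 1), ε k)) (ℱ n), hstep n] with ω hsub hω
  have hsub' : (μ[fun ω => a (n + 1) ω - ∑ k ∈ Finset.range (n + 1), ε k | ℱ n]) ω =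
      (μ[a (n + 1) | ℱ n]) ω - ∑ k ∈ Finset.range (n + 1), ε k := by
    rw [condExp_const (ℱ.le n)] at hsub
    exact hsub
  rw [hsub', Finset.sum_range_succ]
  linarith

theorem ae_exists_tendsto_of_condExp_succ_le (ha : StronglyAdapted ℱ a)
    (hint : ∀ n, Integrable (a n) μ) (ha0 : ∀ n ω, 0 ≤ a n ω)
    (hε : ∀ n, 0 ≤ ε n) (hεsum : Summable ε)
    (hstep : ∀ n, μ[a (n + 1) | ℱ n] ≤ᵐ[μ] fun ω => a n ω + ε n) :
    ∀ᵐ ω ∂μ, ∃ x, Tendsto (fun n => a n ω) atTop (𝓝 x) := by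
  set s : ℕ → ℝ := fun n => ∑ k ∈ Finset.range n, ε k
  have hs0 n : 0 ≤ s n := Finset.sum_nonneg fun k _ => hε k
  have hs n : s n ≤ ∑' k, ε k := hεsum.sum_le_tsum _ fun k _ => hε k
  have hmean n : ∫ ω, a n ω ∂μ ≤ ∫ ω, a 0 ω ∂μ + ∑' k, ε k :=
    le_add_tsum_of_succ_le (γ := 0) (fun n => integral_nonneg (ha0 n)) (fun _ => le_rfl)
      (integral_succ_le_of_condExp_succ_le hint
        (by simpa only [Pi.zero_apply, sub_zero, one_mul] using hstep)) hε hεsum n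
  have hbdd n : eLpNorm (fun ω => -(a n ω - s n)) 1 μ ≤
      (∫ ω, a 0 ω ∂μ + 2 * ∑' k, ε k).toNNReal := by
    have hi : Integrable (fun ω => -(a n ω - s n)) μ := ((hint n).sub (integrable_const _)).neg
    rw [eLpNorm_one_eq_lintegral_enorm, ← ofReal_integral_norm_eq_lintegral_enorm hi]
    refine ENNReal.ofReal_le_ofReal ?_
    calc ∫ ω, ‖-(a n ω - s n)‖ ∂μ ≤ ∫ ω, (a n ω + s n) ∂μ := by
          refine integral_mono hi.norm ((hint n).add (integrable_const _)) fun ω => ?_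
          rw [norm_neg, Real.norm_eq_abs, abs_le]
          constructor <;> linarith [ha0 n ω, hs0 n]
      _ = ∫ ω, a n ω ∂μ + s n := by
          rw [integral_add (hint n) (integrable_const _), integral_const, probReal_univ, one_smul]
      _ ≤ _ := by linarith [hmean n, hs n]
  filter_upwards [(supermartingale_sub_sum_of_condExp_succ_le ha hint
    hstep).neg.exists_ae_tendsto_of_bdd hbdd] with ω ⟨x, hx⟩
  refine ⟨_, (hεsum.hasSum.tendsto_sum_nat.sub hx).congr fun n => ?_⟩
  simp only [Pi.neg_apply]
  ring

theorem ae_tendsto_zero_of_condExp_succ_le (ha : StronglyAdapted ℱ a)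
    (hint : ∀ n, Integrable (a n) μ) (ha0 : ∀ n ω, 0 ≤ a n ω)
    (hγ : ∀ n, 0 ≤ γ n) (hγsum : ¬ Summable γ) (hε : ∀ n, 0 ≤ ε n) (hεsum : Summable ε)
    (hstep : ∀ n, μ[a (n + 1) | ℱ n] ≤ᵐ[μ] fun ω => (1 - γ n) * a n ω + ε n) :
    ∀ᵐ ω ∂μ, Tendsto (fun n => a n ω) atTop (𝓝 0) := by
  have hconv : ∀ᵐ ω ∂μ, ∃ x, Tendsto (fun n => a n ω) atTop (𝓝 x) := by
    refine ae_exists_tendsto_of_condExp_succ_le ha hint ha0 hε hεsum fun n => ?_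
    filter_upwards [hstep n] with ω hω
    linarith [mul_nonneg (hγ n) (ha0 n ω)]
  have hsum : ∀ᵐ ω ∂μ, Summable fun n => γ n * a n ω := by
    refine ae_summable_of_summable_integral (fun n => (hint n).const_mul _)
      (fun n ω => mul_nonneg (hγ n) (ha0 n ω)) ?_
    simpa only [integral_const_mul] using
      summable_mul_of_succ_le (fun n => integral_nonneg (ha0 n)) hγ
        (integral_succ_le_of_condExp_succ_le hint hstep) hε hεsum
  filter_upwards [hconv, hsum] with ω ⟨x, hx⟩ hω
  exact eq_zero_of_tendsto_of_summable_mul hγsum hω hx ▸ hx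

end AlmostSupermartingale

section RobbinsMonro

variable {H S Ω : Type*} [NormedAddCommGroup H] [InnerProductSpace ℝ H]
  [MeasurableSpace S]

theorem integral_norm_sub_smul_sq_le [CompleteSpace H] {ν : Measure S} [IsProbabilityMeasure ν]
    {F : S → H} {c K r : ℝ} {x : H} (hF : MemLp F 2 ν) (hK : ∫ w, ‖F w‖ ^ 2 ∂ν ≤ K)
    (hc : c * ‖x‖ ^ 2 ≤ inner ℝ x (∫ w, F w ∂ν)) (hr : 0 ≤ r) :
    ∫ w, ‖x - r • F w‖ ^ 2 ∂ν ≤ (1 - 2 * c * r) * ‖x‖ ^ 2 + K * r ^ 2 := by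
  have hint : Integrable F ν := hF.integrable one_le_two
  have hconst : Integrable (fun _ : S => ‖x‖ ^ 2) ν := integrable_const _
  have hinner : Integrable (fun w => 2 * r * inner ℝ x (F w)) ν :=
    (hint.const_inner x).const_mul _
  have hsq : Integrable (fun w => r ^ 2 * ‖F w‖ ^ 2) ν := hF.norm.integrable_sq.const_mul _
  calc ∫ w, ‖x - r • F w‖ ^ 2 ∂ν
      = ∫ w, (‖x‖ ^ 2 - 2 * r * inner ℝ x (F w) + r ^ 2 * ‖F w‖ ^ 2) ∂ν := by
        refine integral_congr_ae (ae_of_all _ fun w => ?_)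
        simp only [norm_sub_sq_real, inner_smul_right, norm_smul, mul_pow, Real.norm_eq_abs,
          sq_abs, mul_assoc]
    _ = ‖x‖ ^ 2 - 2 * r * inner ℝ x (∫ w, F w ∂ν) + r ^ 2 * ∫ w, ‖F w‖ ^ 2 ∂ν := by
        rw [integral_add (by exact hconst.sub hinner) hsq, integral_sub hconst hinner,
          integral_const_mul, integral_const_mul, integral_inner hint, integral_const,
          probReal_univ, one_smul]
    _ ≤ (1 - 2 * c * r) * ‖x‖ ^ 2 + K * r ^ 2 := by
        linarith [mul_le_mul_of_nonneg_left hc hr, mul_le_mul_of_nonneg_left hK (sq_nonneg r)]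

variable [MeasurableSpace H]

/-- `G ϑ w` is a square integrable estimator, from a sample `w` of law `ν`, of a vector field on
`Θ` that is strongly monotone at `θstar` with constant `c`: the drift condition under which the
recursion `ϑ ↦ ϑ - γ • G ϑ w` is attracted by `θstar`. The second moments are bounded by `K`. -/
structure IsMonotoneEstimator (ν : Measure S) (G : H → S → H) (Θ : Set H) (θstar : H) (c K : ℝ) :
    Prop where
  measurable : Measurable (Function.uncurry G)
  memLp : ∀ ϑ ∈ Θ, MemLp (G ϑ) 2 ν
  integral_norm_sq_le : ∀ ϑ ∈ Θ, ∫ w, ‖G ϑ w‖ ^ 2 ∂ν ≤ K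
  mul_norm_sq_le_inner : ∀ ϑ ∈ Θ,
    c * ‖ϑ - θstar‖ ^ 2 ≤ inner ℝ (ϑ - θstar) (∫ w, G ϑ w ∂ν)

namespace IsMonotoneEstimator

variable [BorelSpace H] [SecondCountableTopology H] {G : H → S → H} {Θ : Set H}
  {θstar : H} {c K : ℝ} {m mΩ : MeasurableSpace Ω} {μ : Measure Ω} [IsProbabilityMeasure μ]

section OneStep

variable {W : Ω → S} {ϑ : Ω → H} {r : ℝ}

theorem stronglyMeasurable_norm_sub_smul_sq {ν : Measure S}
    (hG : IsMonotoneEstimator ν G Θ θstar c K) (r : ℝ) :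
    StronglyMeasurable fun z : H × S => ‖z.1 - θstar - r • G z.1 z.2‖ ^ 2 := by
  have hGm : Measurable fun z : H × S => G z.1 z.2 := hG.measurable
  exact (by fun_prop : Measurable _).stronglyMeasurable

variable [CompleteSpace H]

theorem integrable_norm_sub_smul_sq (hG : IsMonotoneEstimator (μ.map W) G Θ θstar c K)
    (hm : m ≤ mΩ) (hϑ : Measurable[m] ϑ) (hϑΘ : ∀ ω, ϑ ω ∈ Θ)
    (hϑint : Integrable (fun ω => ‖ϑ ω - θstar‖ ^ 2) μ) (hW : Measurable W)
    (hind : Indep m (MeasurableSpace.comap W inferInstance) μ) (hr : 0 ≤ r) :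
    Integrable (fun ω => ‖ϑ ω - θstar - r • G (ϑ ω) (W ω)‖ ^ 2) μ := by
  have : IsProbabilityMeasure (μ.map W) := Measure.isProbabilityMeasure_map hW.aemeasurable
  have hf := hG.stronglyMeasurable_norm_sub_smul_sq r
  refine integrable_comp_prodMk_of_indep hm hϑ hW hind hf (fun ω => ?_) ?_
  · exact (((memLp_const (ϑ ω - θstar)).sub
      ((hG.memLp _ (hϑΘ ω)).const_smul r)).norm).integrable_sq
  · refine ((hϑint.const_mul (1 - 2 * c * r)).add (integrable_const (K * r ^ 2))).mono'
      (hf.norm.integral_prod_right'.comp_measurable (hϑ.mono hm le_rfl)).aestronglyMeasurable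
      (ae_of_all _ fun ω => ?_)
    simp only [norm_pow, norm_norm, Real.norm_of_nonneg (integral_nonneg fun _ => sq_nonneg _)]
    exact integral_norm_sub_smul_sq_le (hG.memLp _ (hϑΘ ω)) (hG.integral_norm_sq_le _ (hϑΘ ω))
      (hG.mul_norm_sq_le_inner _ (hϑΘ ω)) hr

theorem condExp_norm_sub_smul_sq_le (hG : IsMonotoneEstimator (μ.map W) G Θ θstar c K)
    (hm : m ≤ mΩ) (hϑ : Measurable[m] ϑ) (hϑΘ : ∀ ω, ϑ ω ∈ Θ)
    (hϑint : Integrable (fun ω => ‖ϑ ω - θstar‖ ^ 2) μ) (hW : Measurable W)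
    (hind : Indep m (MeasurableSpace.comap W inferInstance) μ) (hr : 0 ≤ r) :
    μ[fun ω => ‖ϑ ω - θstar - r • G (ϑ ω) (W ω)‖ ^ 2 | m] ≤ᵐ[μ]
      fun ω => (1 - 2 * c * r) * ‖ϑ ω - θstar‖ ^ 2 + K * r ^ 2 := by
  have : IsProbabilityMeasure (μ.map W) := Measure.isProbabilityMeasure_map hW.aemeasurable
  filter_upwards [condExp_comp_prodMk_of_indep hm hϑ hW hind
    (hG.stronglyMeasurable_norm_sub_smul_sq r)
    (hG.integrable_norm_sub_smul_sq hm hϑ hϑΘ hϑint hW hind hr)] with ω hω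
  rw [hω]
  exact integral_norm_sub_smul_sq_le (hG.memLp _ (hϑΘ ω)) (hG.integral_norm_sq_le _ (hϑΘ ω))
    (hG.mul_norm_sq_le_inner _ (hϑΘ ω)) hr

end OneStep

theorem ae_tendsto_of_norm_sub_le [CompleteSpace H] {ν : Measure S}
    (hG : IsMonotoneEstimator ν G Θ θstar c K) (hc : 0 < c) {ℱ : Filtration ℕ mΩ}
    {θ : ℕ → Ω → H} (hθ : ∀ n, Measurable[ℱ n] (θ n)) (hθΘ : ∀ n ω, θ n ω ∈ Θ)
    (hθint : Integrable (fun ω => ‖θ 0 ω - θstar‖ ^ 2) μ)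
    {W : ℕ → Ω → S} (hW : ∀ n, Measurable (W n)) (hlaw : ∀ n, μ.map (W n) = ν)
    (hind : ∀ n, Indep (ℱ n) (MeasurableSpace.comap (W n) inferInstance) μ)
    {γ : ℕ → ℝ} (hγ : ∀ n, 0 ≤ γ n) (hγsum : ¬ Summable γ) (hγsq : Summable fun n => γ n ^ 2)
    (hstep : ∀ n ω, ‖θ (n + 1) ω - θstar‖ ≤ ‖θ n ω - θstar - γ n • G (θ n ω) (W n ω)‖) :
    ∀ᵐ ω ∂μ, Tendsto (fun n => θ n ω) atTop (𝓝 θstar) := by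
  have hG' n : IsMonotoneEstimator (μ.map (W n)) G Θ θstar c K := hlaw n ▸ hG
  have hdist : ∀ n, StronglyMeasurable[ℱ n] fun ω => ‖θ n ω - θstar‖ ^ 2 := fun n => by
    have := hθ n
    exact Measurable.stronglyMeasurable (by fun_prop)
  have hsq n ω : ‖θ (n + 1) ω - θstar‖ ^ 2 ≤
      ‖θ n ω - θstar - γ n • G (θ n ω) (W n ω)‖ ^ 2 :=
    pow_le_pow_left₀ (norm_nonneg _) (hstep n ω) 2
  have hint n : Integrable (fun ω => ‖θ n ω - θstar‖ ^ 2) μ := by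
    induction n with
    | zero => exact hθint
    | succ n ih =>
      refine ((hG' n).integrable_norm_sub_smul_sq (ℱ.le n) (hθ n) (hθΘ n) ih (hW n) (hind n)
        (hγ n)).mono' ((hdist (n + 1)).mono (ℱ.le _)).aestronglyMeasurable
        (ae_of_all _ fun ω => ?_)
      simpa only [norm_pow, norm_norm] using hsq n ω
  have hK : 0 ≤ K := by
    obtain ⟨ω⟩ := μ.nonempty_of_neZero
    exact (integral_nonneg fun w => sq_nonneg _).trans (hG.integral_norm_sq_le _ (hθΘ 0 ω))
  have hzero : ∀ᵐ ω ∂μ, Tendsto (fun n => ‖θ n ω - θstar‖ ^ 2) atTop (𝓝 0) := by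
    refine ae_tendsto_zero_of_condExp_succ_le (ℱ := ℱ) (γ := fun n => 2 * c * γ n)
      (ε := fun n => K * γ n ^ 2) hdist hint (fun n ω => sq_nonneg _)
      (fun n => mul_nonneg (by positivity) (hγ n)) ?_ (fun n => by positivity)
      (hγsq.mul_left K) fun n => ?_
    · rwa [summable_mul_left_iff (by positivity)]
    · have hint' := (hG' n).integrable_norm_sub_smul_sq (ℱ.le n) (hθ n) (hθΘ n) (hint n) (hW n)
        (hind n) (hγ n)
      exact (condExp_mono (hint (n + 1)) hint' (ae_of_all _ (hsq n))).trans
        ((hG' n).condExp_norm_sub_smul_sq_le (ℱ.le n) (hθ n) (hθΘ n) (hint n) (hW n) (hind n)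
          (hγ n))
  filter_upwards [hzero] with ω hω
  rw [tendsto_iff_norm_sub_tendsto_zero]
  simpa only [Real.sqrt_sq (norm_nonneg _), Real.sqrt_zero] using hω.sqrt

end IsMonotoneEstimator

end RobbinsMonro

section History

variable {Ω S : Type*} {mΩ : MeasurableSpace Ω} [mS : MeasurableSpace S] {W : ℕ → Ω → S}

/-- The filtration whose `n`th σ-algebra is generated by `W i`, `i < n`, so that `W n` is the
innovation of the step from `n` to `n + 1`. (`Filtration.natural` includes `W n` and requires a
metrizable state space, which excludes path spaces.) -/
def historyFiltration (W : ℕ → Ω → S) (hW : ∀ n, Measurable (W n)) : Filtration ℕ mΩ where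
  seq n := ⨆ i ∈ Set.Iio n, mS.comap (W i)
  mono' _ _ hnm := biSup_mono fun _ hi => lt_of_lt_of_le hi hnm
  le' _ := iSup₂_le fun i _ => (hW i).comap_le

theorem measurable_historyFiltration (hW : ∀ n, Measurable (W n)) {i n : ℕ} (hi : i < n) :
    Measurable[historyFiltration W hW n] (W i) :=
  measurable_iff_comap_le.2
    (le_iSup₂_of_le (f := fun j (_ : j ∈ Set.Iio n) => mS.comap (W j)) i hi le_rfl)

theorem indep_historyFiltration {μ : Measure Ω} (hW : ∀ n, Measurable (W n))
    (hind : iIndepFun W μ) (n : ℕ) :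
    Indep (historyFiltration W hW n) (mS.comap (W n)) μ := by
  have h := indep_iSup_of_disjoint (S := Set.Iio n) (T := {n}) (fun i => (hW i).comap_le) hind
    (Set.disjoint_singleton_right.2 (lt_irrefl n))
  rwa [iSup_singleton] at h

end History

section ProjectedRobbinsMonro

variable {q : ℕ} {S Ω : Type*} [MeasurableSpace S] {mΩ : MeasurableSpace Ω}
  {G : E q → S → E q} {Θ : Set (E q)} {W : ℕ → Ω → S} {γ : ℕ → ℝ} {θ : ℕ → Ω → E q}

theorem measurable_projected_robbinsMonro (hG : Measurable (Function.uncurry G))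
    (hΘc : IsClosed Θ) (hΘ : Convex ℝ Θ) (hne : Θ.Nonempty) (hW : ∀ n, Measurable (W n))
    {θ₀ : E q} (hθzero : ∀ ω, θ 0 ω = θ₀)
    (hθsucc : ∀ n ω, IsProj Θ (θ n ω - γ n • G (θ n ω) (W n ω)) (θ (n + 1) ω)) (n : ℕ) :
    Measurable[historyFiltration W hW n] (θ n) := by
  obtain ⟨π, hπ, hπeq⟩ := exists_lipschitzWith_forall_isProj hΘc hΘ hne
  induction n with
  | zero => exact (funext hθzero : θ 0 = fun _ => θ₀) ▸ measurable_const
  | succ n ih =>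
    have hθ : Measurable[historyFiltration W hW (n + 1)] (θ n) :=
      ih.mono ((historyFiltration W hW).mono n.le_succ) le_rfl
    rw [show θ (n + 1) = fun ω => π (θ n ω - γ n • G (θ n ω) (W n ω)) from
      funext fun ω => hπeq _ _ (hθsucc n ω)]
    exact hπ.continuous.measurable.comp (hθ.sub
      ((hG.comp (hθ.prodMk (measurable_historyFiltration hW n.lt_succ_self))).const_smul (γ n)))

theorem ae_tendsto_of_projected_robbinsMonro {ν : Measure S} {θstar : E q} {c K : ℝ}
    (hG : IsMonotoneEstimator ν G Θ θstar c K) (hc : 0 < c) (hΘc : IsClosed Θ) (hΘ : Convex ℝ Θ)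
    (hθstar : θstar ∈ Θ) {μ : Measure Ω} [IsProbabilityMeasure μ]
    (hW : ∀ n, Measurable (W n)) (hlaw : ∀ n, μ.map (W n) = ν) (hind : iIndepFun W μ)
    (hγ : ∀ n, 0 ≤ γ n) (hγsum : ¬ Summable γ) (hγsq : Summable fun n => γ n ^ 2)
    {θ₀ : E q} (hθ₀ : θ₀ ∈ Θ) (hθzero : ∀ ω, θ 0 ω = θ₀)
    (hθsucc : ∀ n ω, IsProj Θ (θ n ω - γ n • G (θ n ω) (W n ω)) (θ (n + 1) ω)) :
    ∀ᵐ ω ∂μ, Tendsto (fun n => θ n ω) atTop (𝓝 θstar) := by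
  refine hG.ae_tendsto_of_norm_sub_le hc (ℱ := historyFiltration W hW)
    (measurable_projected_robbinsMonro hG.measurable hΘc hΘ ⟨_, hθstar⟩ hW hθzero hθsucc)
    ?_ ?_ hW hlaw (indep_historyFiltration hW hind) hγ hγsum hγsq fun n ω => ?_
  · rintro (_ | n) ω
    · exact hθzero ω ▸ hθ₀
    · exact (hθsucc n ω).1
  · simp only [hθzero]
    exact integrable_const _
  · rw [sub_right_comm]
    exact (hθsucc n ω).norm_sub_le_norm_sub hΘ (isProj_self hθstar)

end ProjectedRobbinsMonro

section GirsanovWeight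

variable {H : Type*} [NormedAddCommGroup H] [InnerProductSpace ℝ H] {T R : ℝ} {x θ : H}

/-- The weight `J⁺(x, θ)` that compensates a drift `θ` in a Brownian motion with value `x` at
time `T`, on an arbitrary real inner product space; see `Setting.Jplus`. -/
noncomputable def girsanovWeight (T : ℝ) (x θ : H) : ℝ :=
  Real.exp (-(inner ℝ θ x) + 1 / 2 * ‖θ‖ ^ 2 * T)

theorem girsanovWeight_pos (T : ℝ) (x θ : H) : 0 < girsanovWeight T x θ := Real.exp_pos _

theorem continuous_girsanovWeight (T : ℝ) :
    Continuous fun z : H × H => girsanovWeight T z.1 z.2 := by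
  unfold girsanovWeight
  fun_prop

theorem girsanovWeight_eq_mul_exp (T : ℝ) (x θ θ' : H) :
    girsanovWeight T x θ' = girsanovWeight T x θ *
      Real.exp (inner ℝ (θ' - θ) (T • θ - x) + T / 2 * ‖θ' - θ‖ ^ 2) := by
  rw [girsanovWeight, girsanovWeight, ← Real.exp_add, norm_sub_sq_real]
  simp only [inner_sub_left, inner_sub_right, inner_smul_right, real_inner_self_eq_norm_sq]
  ring_nf

/-- Strong convexity in `θ`, the gradient of the weight being `J⁺(x, θ) (T θ - x)`. -/
theorem girsanovWeight_add_inner_le (T : ℝ) (x θ θ' : H) :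
    girsanovWeight T x θ * (1 + T / 2 * ‖θ' - θ‖ ^ 2) +
      inner ℝ (θ' - θ) (girsanovWeight T x θ • (T • θ - x)) ≤ girsanovWeight T x θ' := by
  rw [girsanovWeight_eq_mul_exp T x θ θ', inner_smul_right, ← mul_add]
  refine mul_le_mul_of_nonneg_left ?_ (girsanovWeight_pos T x θ).le
  linarith [Real.add_one_le_exp (inner ℝ (θ' - θ) (T • θ - x) + T / 2 * ‖θ' - θ‖ ^ 2)]

theorem girsanovWeight_le (hT : 0 ≤ T) (hθ : ‖θ‖ ≤ R) (x : H) :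
    girsanovWeight T x θ ≤ Real.exp (R ^ 2 * T + R * ‖x‖) := by
  refine Real.exp_le_exp.2 ?_
  have hinner : -(inner ℝ θ x) ≤ R * ‖x‖ :=
    ((neg_le_abs _).trans (abs_real_inner_le_norm θ x)).trans (by gcongr)
  have hsq : ‖θ‖ ^ 2 * T ≤ R ^ 2 * T := by gcongr
  linarith [mul_nonneg (sq_nonneg ‖θ‖) hT]

theorem girsanovWeight_mul_one_add_norm_le (hT : 0 ≤ T) (hθ : ‖θ‖ ≤ R) (x : H) :
    girsanovWeight T x θ * (1 + ‖T • θ - x‖) ≤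
      Real.exp (R ^ 2 * T + T * R) * Real.exp ((R + 1) * ‖x‖) := by
  have hnorm : 1 + ‖T • θ - x‖ ≤ Real.exp (T * R + ‖x‖) :=
    calc 1 + ‖T • θ - x‖ ≤ 1 + (T * ‖θ‖ + ‖x‖) := by
          simpa only [norm_smul, Real.norm_of_nonneg hT] using
            add_le_add_right (norm_sub_le (T • θ) x) 1
      _ ≤ T * R + ‖x‖ + 1 := by linarith [mul_le_mul_of_nonneg_left hθ hT]
      _ ≤ Real.exp (T * R + ‖x‖) := Real.add_one_le_exp _
  calc girsanovWeight T x θ * (1 + ‖T • θ - x‖)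
      ≤ Real.exp (R ^ 2 * T + R * ‖x‖) * Real.exp (T * R + ‖x‖) := by
        gcongr
        exact girsanovWeight_le hT hθ x
    _ = Real.exp (R ^ 2 * T + T * R) * Real.exp ((R + 1) * ‖x‖) := by
        rw [← Real.exp_add, ← Real.exp_add]
        ring_nf

end GirsanovWeight

section TiltedMoment

variable {H S : Type*} [NormedAddCommGroup H] [InnerProductSpace ℝ H] {Q : S → ℝ} {x : S → H}
  {T R : ℝ} {θ θ' θstar : H} {Θ : Set H}

/-- The estimator `(T θ - x) Q J⁺(x, θ)` of the gradient of `tiltedMoment`. -/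
noncomputable def tiltedGradient (Q : S → ℝ) (x : S → H) (T : ℝ) (θ : H) (s : S) : H :=
  (Q s * girsanovWeight T (x s) θ) • (T • θ - x s)

theorem mul_girsanovWeight_nonneg (hQ : ∀ s, 0 ≤ Q s) (x : S → H) (T : ℝ) (θ : H) (s : S) :
    0 ≤ Q s * girsanovWeight T (x s) θ :=
  mul_nonneg (hQ s) (girsanovWeight_pos _ _ _).le

theorem mul_girsanovWeight_add_norm_tiltedGradient_le (hQ : ∀ s, 0 ≤ Q s) (hT : 0 ≤ T)
    (hθ : ‖θ‖ ≤ R) (s : S) :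
    Q s * girsanovWeight T (x s) θ + ‖tiltedGradient Q x T θ s‖ ≤
      Real.exp (R ^ 2 * T + T * R) * (Q s * Real.exp ((R + 1) * ‖x s‖)) := by
  rw [tiltedGradient, norm_smul, Real.norm_of_nonneg (mul_girsanovWeight_nonneg hQ x T θ s)]
  linarith [mul_le_mul_of_nonneg_left (girsanovWeight_mul_one_add_norm_le hT hθ (x s)) (hQ s)]

variable [MeasurableSpace S] {ν : Measure S}

/-- The variance functional `θ ↦ E[Q J⁺(x, θ)]` of a quantity `Q` observed together with `x`. -/
noncomputable def tiltedMoment (ν : Measure S) (Q : S → ℝ) (x : S → H) (T : ℝ) (θ : H) : ℝ :=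
  ∫ s, Q s * girsanovWeight T (x s) θ ∂ν

theorem tiltedMoment_pos (hQ : ∀ s, 0 ≤ Q s)
    (hθ : Integrable (fun s => Q s * girsanovWeight T (x s) θ) ν) (hQpos : 0 < ν {s | Q s ≠ 0}) :
    0 < tiltedMoment ν Q x T θ := by
  rw [tiltedMoment, integral_pos_iff_support_of_nonneg (mul_girsanovWeight_nonneg hQ x T θ) hθ]
  exact hQpos.trans_le
    (measure_mono fun s hs => mul_ne_zero hs (girsanovWeight_pos _ _ _).ne')

theorem tiltedMoment_add_inner_le [CompleteSpace H] (hQ : ∀ s, 0 ≤ Q s)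
    (hθ : Integrable (fun s => Q s * girsanovWeight T (x s) θ) ν)
    (hθ' : Integrable (fun s => Q s * girsanovWeight T (x s) θ') ν)
    (hgrad : Integrable (tiltedGradient Q x T θ) ν) :
    tiltedMoment ν Q x T θ * (1 + T / 2 * ‖θ' - θ‖ ^ 2) +
      inner ℝ (θ' - θ) (∫ s, tiltedGradient Q x T θ s ∂ν) ≤ tiltedMoment ν Q x T θ' := by
  have hinner := hgrad.const_inner (𝕜 := ℝ) (θ' - θ)
  have hmul := hθ.mul_const (1 + T / 2 * ‖θ' - θ‖ ^ 2)
  rw [tiltedMoment, tiltedMoment, ← integral_inner hgrad, ← integral_mul_const,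
    ← integral_add hmul hinner]
  refine integral_mono (hmul.add hinner) hθ' fun s => ?_
  have hconv := mul_le_mul_of_nonneg_left (girsanovWeight_add_inner_le T (x s) θ θ') (hQ s)
  simpa only [tiltedGradient, mul_smul, inner_smul_right, mul_add, mul_assoc, mul_left_comm]
    using hconv

theorem mul_norm_sq_le_inner_integral_tiltedGradient [CompleteSpace H] (hQ : ∀ s, 0 ≤ Q s)
    (hT : 0 ≤ T) (hθ : Integrable (fun s => Q s * girsanovWeight T (x s) θ) ν)
    (hθstar : Integrable (fun s => Q s * girsanovWeight T (x s) θstar) ν)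
    (hgrad : Integrable (tiltedGradient Q x T θ) ν)
    (hle : tiltedMoment ν Q x T θstar ≤ tiltedMoment ν Q x T θ) :
    T / 2 * tiltedMoment ν Q x T θstar * ‖θ - θstar‖ ^ 2 ≤
      inner ℝ (θ - θstar) (∫ s, tiltedGradient Q x T θ s ∂ν) := by
  have hconv := tiltedMoment_add_inner_le hQ hθ hθstar hgrad
  rw [← neg_sub θ θstar, inner_neg_left, norm_neg] at hconv
  have hcoef : T / 2 * ‖θ - θstar‖ ^ 2 * tiltedMoment ν Q x T θstar ≤
      T / 2 * ‖θ - θstar‖ ^ 2 * tiltedMoment ν Q x T θ := by gcongr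
  linarith

variable [MeasurableSpace H] [BorelSpace H] [SecondCountableTopology H]

theorem measurable_mul_girsanovWeight (hQ : Measurable Q) (hx : Measurable x) (T : ℝ) :
    Measurable fun z : H × S => Q z.2 * girsanovWeight T (x z.2) z.1 :=
  (hQ.comp measurable_snd).mul
    ((continuous_girsanovWeight T).measurable.comp ((hx.comp measurable_snd).prodMk measurable_fst))

theorem measurable_uncurry_tiltedGradient (hQ : Measurable Q) (hx : Measurable x) (T : ℝ) :
    Measurable (Function.uncurry (tiltedGradient Q x T)) :=
  (measurable_mul_girsanovWeight hQ hx T).smul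
    ((measurable_fst.const_smul T).sub (hx.comp measurable_snd))

theorem memLp_mul_girsanovWeight (hQ : ∀ s, 0 ≤ Q s) (hQm : Measurable Q) (hx : Measurable x)
    (hT : 0 ≤ T) {p : ℝ≥0∞} (henv : ∀ a, MemLp (fun s => Q s * Real.exp (a * ‖x s‖)) p ν)
    (θ : H) : MemLp (fun s => Q s * girsanovWeight T (x s) θ) p ν := by
  refine ((henv (‖θ‖ + 1)).const_mul (Real.exp (‖θ‖ ^ 2 * T + T * ‖θ‖))).mono'
    ((measurable_mul_girsanovWeight hQm hx T).comp measurable_prodMk_left).aestronglyMeasurable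
    (ae_of_all _ fun s => ?_)
  rw [Real.norm_of_nonneg (mul_girsanovWeight_nonneg hQ x T θ s)]
  exact (le_add_of_nonneg_right (norm_nonneg _)).trans
    (mul_girsanovWeight_add_norm_tiltedGradient_le hQ hT le_rfl s)

theorem memLp_tiltedGradient (hQ : ∀ s, 0 ≤ Q s) (hQm : Measurable Q) (hx : Measurable x)
    (hT : 0 ≤ T) {p : ℝ≥0∞} (henv : ∀ a, MemLp (fun s => Q s * Real.exp (a * ‖x s‖)) p ν)
    (θ : H) : MemLp (tiltedGradient Q x T θ) p ν := by
  refine ((henv (‖θ‖ + 1)).const_mul (Real.exp (‖θ‖ ^ 2 * T + T * ‖θ‖))).mono'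
    ((measurable_uncurry_tiltedGradient hQm hx T).of_uncurry_left (x := θ)).aestronglyMeasurable
    (ae_of_all _ fun s => ?_)
  exact (le_add_of_nonneg_left (mul_girsanovWeight_nonneg hQ x T θ s)).trans
    (mul_girsanovWeight_add_norm_tiltedGradient_le hQ hT le_rfl s)

theorem integral_norm_tiltedGradient_sq_le (hQ : ∀ s, 0 ≤ Q s) (hQm : Measurable Q)
    (hx : Measurable x) (hT : 0 ≤ T)
    (henv : ∀ a, MemLp (fun s => Q s * Real.exp (a * ‖x s‖)) 2 ν) (hθ : ‖θ‖ ≤ R) :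
    ∫ s, ‖tiltedGradient Q x T θ s‖ ^ 2 ∂ν ≤
      ∫ s, (Real.exp (R ^ 2 * T + T * R) * (Q s * Real.exp ((R + 1) * ‖x s‖))) ^ 2 ∂ν := by
  refine integral_mono (memLp_tiltedGradient hQ hQm hx hT henv θ).norm.integrable_sq
    ((henv (R + 1)).const_mul _).integrable_sq fun s => ?_
  exact pow_le_pow_left₀ (norm_nonneg _)
    ((le_add_of_nonneg_left (mul_girsanovWeight_nonneg hQ x T θ s)).trans
      (mul_girsanovWeight_add_norm_tiltedGradient_le hQ hT hθ s)) 2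

theorem exists_isMonotoneEstimator_tiltedGradient [CompleteSpace H] [IsFiniteMeasure ν]
    (hQ : ∀ s, 0 ≤ Q s) (hQm : Measurable Q) (hx : Measurable x) (hT : 0 < T)
    (hQpos : 0 < ν {s | Q s ≠ 0})
    (henv : ∀ a, MemLp (fun s => Q s * Real.exp (a * ‖x s‖)) 2 ν) (hΘ : Bornology.IsBounded Θ)
    (hmin : IsMinOn (tiltedMoment ν Q x T) Θ θstar) :
    ∃ c K, 0 < c ∧ IsMonotoneEstimator ν (tiltedGradient Q x T) Θ θstar c K := by
  obtain ⟨R, hR⟩ := hΘ.exists_norm_le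
  have hint θ : Integrable (fun s => Q s * girsanovWeight T (x s) θ) ν :=
    (memLp_mul_girsanovWeight hQ hQm hx hT.le henv θ).integrable one_le_two
  have hgrad θ : MemLp (tiltedGradient Q x T θ) 2 ν := memLp_tiltedGradient hQ hQm hx hT.le henv θ
  have hpos := tiltedMoment_pos hQ (hint θstar) hQpos
  exact ⟨T / 2 * tiltedMoment ν Q x T θstar, _, by positivity,
    { measurable := measurable_uncurry_tiltedGradient hQm hx T
      memLp := fun θ _ => hgrad θ
      integral_norm_sq_le := fun θ hθ =>
        integral_norm_tiltedGradient_sq_le hQ hQm hx hT.le henv (hR θ hθ)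
      mul_norm_sq_le_inner := fun θ hθ => mul_norm_sq_le_inner_integral_tiltedGradient hQ hT.le
        (hint θ) (hint θstar) ((hgrad θ).integrable one_le_two) (hmin hθ) }⟩

end TiltedMoment

section ExponentialMoments

theorem memLp_sq_mul {Ω : Type*} {mΩ : MeasurableSpace Ω} {μ : Measure Ω} [IsFiniteMeasure μ]
    {f g : Ω → ℝ} {p r : ℝ≥0∞} (hrp : 2 * r < p) (hf : MemLp f p μ)
    (hg : ∀ s ≠ ∞, MemLp g s μ) : MemLp (fun ω => f ω ^ 2 * g ω) r μ := by
  have hlt : p⁻¹ < (2 * r)⁻¹ := ENNReal.inv_lt_inv.2 hrp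
  have hfg : ENNReal.HolderTriple p ((2 * r)⁻¹ - p⁻¹)⁻¹ (2 * r) :=
    ⟨by rw [inv_inv, add_tsub_cancel_of_le hlt.le]⟩
  have hff : ENNReal.HolderTriple (2 * r) (2 * r) r :=
    ⟨by rw [← two_mul, ENNReal.mul_inv (.inl two_ne_zero) (.inl ENNReal.ofNat_ne_top), ← mul_assoc,
      ENNReal.mul_inv_cancel two_ne_zero ENNReal.ofNat_ne_top, one_mul]⟩
  have hfgLp : MemLp (f * g) (2 * r) μ :=
    (hg _ (ENNReal.inv_ne_top.2 (tsub_pos_of_lt hlt).ne')).mul hf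
  refine (hfgLp.mul (hf.mono_exponent hrp.le)).ae_eq (ae_of_all _ fun ω => ?_)
  simp only [Pi.mul_apply, sq, mul_assoc]

section Gaussian

variable {F : Type*} [NormedAddCommGroup F] [NormedSpace ℝ F] [MeasurableSpace F] [BorelSpace F]
  [CompleteSpace F] [SecondCountableTopology F] (ν : Measure F) [IsGaussian ν]

theorem integrable_exp_mul_norm_of_isGaussian (a : ℝ) :
    Integrable (fun x => Real.exp (a * ‖x‖)) ν := by
  obtain ⟨C, hC, hint⟩ := IsGaussian.exists_integrable_exp_sq ν
  refine (hint.const_mul (Real.exp (a ^ 2 / (4 * C)))).mono' (by fun_prop)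
    (ae_of_all _ fun x => ?_)
  rw [Real.norm_of_nonneg (Real.exp_pos _).le, ← Real.exp_add, Real.exp_le_exp]
  have hsq : a ^ 2 / (4 * C) + C * ‖x‖ ^ 2 - a * ‖x‖ = (a - 2 * C * ‖x‖) ^ 2 / (4 * C) := by
    field_simp
    ring
  linarith [div_nonneg (sq_nonneg (a - 2 * C * ‖x‖)) (by positivity : 0 ≤ 4 * C)]

theorem memLp_exp_mul_norm_of_isGaussian (a : ℝ) {r : ℝ≥0∞} (hr : r ≠ ∞) :
    MemLp (fun x => Real.exp (a * ‖x‖)) r ν := by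
  have hmeas : AEStronglyMeasurable (fun x => Real.exp (a * ‖x‖)) ν := by fun_prop
  rcases eq_or_ne r 0 with rfl | hr0
  · exact memLp_zero_iff_aestronglyMeasurable.2 hmeas
  · refine (integrable_norm_rpow_iff hmeas hr0 hr).1 ?_
    simpa only [Real.norm_of_nonneg (Real.exp_pos _).le, ← Real.exp_mul, mul_right_comm] using
      integrable_exp_mul_norm_of_isGaussian ν (a * r.toReal)

end Gaussian

namespace IsBrownianMotion

variable {Ω : Type*} {mΩ : MeasurableSpace Ω} {q : ℕ} {μ : Measure Ω} {ℱ : Filtration ℝ≥0 mΩ}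
  {B : ℝ≥0 → Ω → E q}

theorem measurable (hB : IsBrownianMotion μ ℱ B) (t : ℝ≥0) : Measurable (B t) :=
  ((hB.adapted t).mono (ℱ.le t)).measurable

theorem isGaussian_map (hB : IsBrownianMotion μ ℱ B) (t : ℝ≥0) : IsGaussian (μ.map (B t)) := by
  have hsub : (fun ω => B t ω - B 0 ω) =ᵐ[μ] B t := by
    filter_upwards [hB.start] with ω h
    rw [h, sub_zero]
  have hlaw : μ.map (B t) = (stdGaussian (E q)).map
      (Real.sqrt t • ContinuousLinearMap.id ℝ (E q)) := by
    rw [← Measure.map_congr hsub, hB.law 0 t t.2, NNReal.coe_zero, sub_zero]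
    rfl
  rw [hlaw]
  infer_instance

theorem memLp_exp_mul_norm (hB : IsBrownianMotion μ ℱ B) (t : ℝ≥0) (a : ℝ) {r : ℝ≥0∞}
    (hr : r ≠ ∞) : MemLp (fun ω => Real.exp (a * ‖B t ω‖)) r μ :=
  have := hB.isGaussian_map t
  (memLp_exp_mul_norm_of_isGaussian (μ.map (B t)) a hr).comp_of_map (hB.measurable t).aemeasurable

end IsBrownianMotion

end ExponentialMoments

namespace Setting

variable {d q : ℕ} {A : Setting d q}

section Measurability

theorem measurable_state (hA : A.Admissible) (h : ℝ≥0) (k : ℕ) :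
    Measurable (fun w : ℝ≥0 → E q => A.state h w k) := by
  induction k with
  | zero => exact measurable_const
  | succ k ih =>
    have hincr : Measurable fun (w : ℝ≥0 → E q) (s : ℝ≥0) => w (k * h + min s h) - w (k * h) :=
      measurable_pi_lambda _ fun s => (measurable_pi_apply _).sub (measurable_pi_apply _)
    exact (hA.step_meas h).comp (ih.prodMk hincr)

theorem measurable_approxPayoff (hA : A.Admissible) (n : ℕ) : Measurable (A.approxPayoff n) :=
  hA.P_meas.comp (measurable_state hA _ _)

theorem measurable_Z (hA : A.Admissible) (l : ℕ) : Measurable (A.Z l) := by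
  unfold Z
  split_ifs
  · exact measurable_approxPayoff hA 1
  · exact (measurable_approxPayoff hA _).sub (measurable_approxPayoff hA _)

theorem measurable_weightedSq (hA : A.Admissible) (varP : ℝ) (l : ℕ) :
    Measurable (A.weightedSq varP l) := by
  have := measurable_Z hA
  unfold weightedSq Y
  split_ifs <;> fun_prop

end Measurability

section Coefficients

theorem bigh_pos (hA : A.Admissible) : 0 < A.bigh :=
  div_pos hA.T_pos (Nat.cast_pos.2 hA.N₀_pos)

theorem M_pos (hA : A.Admissible) : (0 : ℝ) < A.M :=
  Nat.cast_pos.2 (zero_lt_two.trans_le hA.two_le_M)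

theorem CLow_pos (hA : A.Admissible) : 0 < A.CLow := by
  have := M_pos hA
  unfold CLow
  positivity

theorem CUp_pos (hA : A.Admissible) : 0 < A.CUp := by
  have := M_pos hA
  unfold CUp
  positivity

theorem bigSigma_pos (hA : A.Admissible) (hβ : 1 < A.β) (varP : ℝ) : 0 < A.bigSigma varP := by
  have hgeom : (A.M : ℝ) ^ ((1 - A.β) / 2) < 1 :=
    Real.rpow_lt_one_of_one_lt_of_neg (Nat.one_lt_cast.2 hA.two_le_M) (by linarith)
  have := sub_pos.2 hgeom
  have := M_pos hA
  have := bigh_pos hA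
  have := CUp_pos hA
  have : 0 ≤ A.lam varP := Real.sqrt_nonneg _
  unfold bigSigma
  positivity

theorem k_pos (hA : A.Admissible) (hβ : 1 < A.β) {varP : ℝ} (hvar : 0 < varP) {l : ℕ}
    (hl : 1 ≤ l) (hW : 2 ≤ l → A.bigW l ≠ 0) : 0 < A.k varP l := by
  have := M_pos hA
  have := bigh_pos hA
  have := CLow_pos hA
  have := bigSigma_pos hA hβ varP
  have := hA.V₁_pos
  have : 0 ≤ A.lam varP := Real.sqrt_nonneg _
  unfold k
  split_ifs with hl1
  · unfold kOne
    positivity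
  · have := abs_pos.2 (hW (by omega))
    unfold kTwo
    positivity

theorem exists_weightedSq_eq (hA : A.Admissible) {varP : ℝ} (hvar : 1 < A.β → 0 < varP) {l : ℕ}
    (hl : 1 ≤ l) (hW : 1 < A.β → 2 ≤ l → A.bigW l ≠ 0) :
    ∃ κ : ℝ, 0 < κ ∧ ∀ w, A.weightedSq varP l w = κ * A.Z l w ^ 2 := by
  by_cases hβ : 1 < A.β
  · refine ⟨A.k varP l, k_pos hA hβ (hvar hβ) hl (hW hβ), fun w => ?_⟩
    rw [weightedSq, if_pos hβ]
  · by_cases hl1 : l = 1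
    · refine ⟨1, one_pos, fun w => ?_⟩
      rw [weightedSq, if_neg hβ, Y, if_pos hl1, one_mul, hl1]
    · have := M_pos hA
      have := bigh_pos hA
      refine ⟨((A.bigh / (A.M : ℝ) ^ (l - 1)) ^ (-A.β / 2)) ^ 2, by positivity, fun w => ?_⟩
      simp only [weightedSq, if_neg hβ, Y, if_neg hl1, mul_pow]

end Coefficients

section Integrability

variable {Ω : Type*} {mΩ : MeasurableSpace Ω} {μ : Measure Ω} {B : ℝ≥0 → Ω → E q}

theorem StrongError.memLp (hA : A.Admissible) (hB : ∀ t, Measurable (B t)) {XT : Ω → E d}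
    (hX : Measurable XT) {p V : ℝ} (hp : 0 < p) (h : A.StrongError μ B XT p V) {n : ℕ}
    (hn : 1 ≤ n) :
    MemLp (fun ω => A.approxPayoff n (fun t => B t ω) - A.P (XT ω)) (ENNReal.ofReal p) μ := by
  have hmeas : Measurable fun ω => A.approxPayoff n (fun t => B t ω) - A.P (XT ω) :=
    ((measurable_approxPayoff hA n).comp (measurable_pi_lambda _ hB)).sub (hA.P_meas.comp hX)
  refine ⟨hmeas.aestronglyMeasurable, ?_⟩
  rw [eLpNorm_lt_top_iff_lintegral_rpow_enorm_lt_top (ENNReal.ofReal_pos.2 hp).ne'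
    ENNReal.ofReal_ne_top, ENNReal.toReal_ofReal hp.le]
  refine lt_of_eq_of_lt (lintegral_congr fun ω => ?_) ((h n hn).trans_lt ENNReal.ofReal_lt_top)
  rw [← ofReal_norm, ENNReal.ofReal_rpow_of_nonneg (norm_nonneg _) hp.le, Real.norm_eq_abs]

theorem memLp_Z (hA : A.Admissible) (hB : ∀ t, Measurable (B t)) {XT : Ω → E d}
    (hX : Measurable XT) {p V : ℝ} (hp : 0 < p) (h : A.StrongError μ B XT p V) {l : ℕ}
    (hZ₁ : l = 1 → MemLp (fun ω => A.Z 1 (fun t => B t ω)) (ENNReal.ofReal p) μ) :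
    MemLp (fun ω => A.Z l (fun t => B t ω)) (ENNReal.ofReal p) μ := by
  by_cases hl : l = 1
  · exact hl ▸ hZ₁ hl
  · have hM j : 1 ≤ A.M ^ j := Nat.one_le_pow _ _ (zero_lt_two.trans_le hA.two_le_M)
    have hsub := (h.memLp hA hB hX hp (hM (l - 1))).sub (h.memLp hA hB hX hp (hM (l - 2)))
    refine hsub.ae_eq (ae_of_all _ fun ω => ?_)
    simp only [Z, if_neg hl, Pi.sub_apply, sub_sub_sub_cancel_right]

theorem memLp_weightedSq_mul_exp [IsProbabilityMeasure μ] {ℱ : Filtration ℝ≥0 mΩ}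
    (hB : IsBrownianMotion μ ℱ B) {varP κ : ℝ} {l : ℕ}
    (hκ : ∀ w, A.weightedSq varP l w = κ * A.Z l w ^ 2) {p r : ℝ≥0∞} (hrp : 2 * r < p)
    (hZ : MemLp (fun ω => A.Z l (fun t => B t ω)) p μ) (t : ℝ≥0) (a : ℝ) :
    MemLp (fun ω => A.weightedSq varP l (fun t => B t ω) * Real.exp (a * ‖B t ω‖)) r μ := by
  simpa only [hκ, mul_assoc] using
    (memLp_sq_mul hrp hZ fun s hs => hB.memLp_exp_mul_norm t a hs).const_mul κ

end Integrability

theorem v_eq_tiltedMoment (hA : A.Admissible) {Ω : Type*} {mΩ : MeasurableSpace Ω}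
    {μ : Measure Ω} {B : ℝ≥0 → Ω → E q} (hB : ∀ t, Measurable (B t)) (varP : ℝ) (l : ℕ) :
    A.v μ B varP l =
      tiltedMoment (μ.map fun ω t => B t ω) (A.weightedSq varP l) (fun w => w A.T) A.T := by
  funext θ
  have hmeas := (measurable_mul_girsanovWeight (measurable_weightedSq hA varP l)
    (measurable_pi_apply A.T) A.T).comp (measurable_prodMk_left (x := θ))
  exact (integral_map (measurable_pi_lambda _ hB).aemeasurable hmeas.aestronglyMeasurable).symm

theorem exists_isMonotoneEstimator_G (hA : A.Admissible) {Ω : Type*} {mΩ : MeasurableSpace Ω}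
    {μ : Measure Ω} [IsProbabilityMeasure μ] {ℱ : Filtration ℝ≥0 mΩ} {B : ℝ≥0 → Ω → E q}
    (hB : IsBrownianMotion μ ℱ B) {varP κ : ℝ} {l : ℕ} (hκpos : 0 < κ)
    (hκ : ∀ w, A.weightedSq varP l w = κ * A.Z l w ^ 2) {p : ℝ≥0∞} (hp : 4 < p)
    (hZp : MemLp (fun ω => A.Z l (fun t => B t ω)) p μ)
    (hZ : 0 < μ {ω | A.Z l (fun t => B t ω) ≠ 0}) {Θ : Set (E q)}
    (hΘ : Bornology.IsBounded Θ) {θstar : E q} (hmin : IsMinOn (A.v μ B varP l) Θ θstar) :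
    ∃ c K, 0 < c ∧ IsMonotoneEstimator (μ.map fun ω t => B t ω) (A.G varP l) Θ θstar c K := by
  have hBm : Measurable fun ω t => B t ω := measurable_pi_lambda _ hB.measurable
  have hQm := measurable_weightedSq hA varP l
  have hx : Measurable fun w : ℝ≥0 → E q => w A.T := measurable_pi_apply A.T
  have := Measure.isProbabilityMeasure_map (μ := μ) hBm.aemeasurable
  have hQpos : 0 < (μ.map fun ω t => B t ω) {w | A.weightedSq varP l w ≠ 0} := by
    have hset := Measure.map_apply (μ := μ) hBm (hQm (measurableSet_singleton 0).compl)
    refine lt_of_lt_of_eq ?_ hset.symm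
    simpa [Set.preimage, hκ, hκpos.ne'] using hZ
  have henv a : MemLp (fun w => A.weightedSq varP l w * Real.exp (a * ‖w A.T‖)) 2
      (μ.map fun ω t => B t ω) :=
    (memLp_map_measure_iff (hQm.mul (hx.norm.const_mul a).exp).aestronglyMeasurable
      hBm.aemeasurable).2
      (memLp_weightedSq_mul_exp hB hκ (lt_of_eq_of_lt (by norm_num) hp) hZp A.T a)
  rw [v_eq_tiltedMoment hA hB.measurable] at hmin
  exact exists_isMonotoneEstimator_tiltedGradient
    (fun w => hκ w ▸ mul_nonneg hκpos.le (sq_nonneg _)) hQm hx hA.T_pos hQpos henv hΘ hmin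

end Setting

end ML2R

theorem theorem3_general {d q : ℕ} (A : ML2R.Setting d q) (hA : A.Admissible)
    {Ω : Type*} [mΩ : MeasurableSpace Ω] (μ : Measure Ω) [IsProbabilityMeasure μ]
    (ℱ : Filtration ℝ≥0 mΩ) (B : ℝ≥0 → Ω → ML2R.E q) (hB : ML2R.IsBrownianMotion μ ℱ B)
    (XT : Ω → ML2R.E d) (hXT : Measurable XT) (l : ℕ) (hl : 1 ≤ l)
    (hvar : 1 < A.β → 0 < variance (fun ω => A.P (XT ω)) μ)
    (hW : 1 < A.β → 2 ≤ l → A.bigW l ≠ 0)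
    (p : ℝ) (hp : 4 < p) (hSE : ∃ V : ℝ, A.StrongError μ B XT p V)
    (hZ₁ : l = 1 → MemLp (fun ω => A.Z 1 (fun t => B t ω)) (ENNReal.ofReal p) μ)
    (hZ : 0 < μ {ω | A.Z l (fun t => B t ω) ≠ 0})
    {Ω' : Type*} [MeasurableSpace Ω'] (μ' : Measure Ω') [IsProbabilityMeasure μ']
    (W : ℕ → ℝ≥0 → Ω' → ML2R.E q) (hWmeas : ∀ n t, Measurable (W n t))
    (hWcopy : ∀ n, IdentDistrib (fun ω t => W n t ω) (fun ω t => B t ω) μ' μ)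
    (hWindep : iIndepFun (fun n ω t => W n t ω) μ')
    (γ : ℕ → ℝ) (hγpos : ∀ n, 1 ≤ n → 0 < γ n)
    (hγsum : ¬ Summable (fun n => γ (n + 1))) (hγsq : Summable (fun n => γ (n + 1) ^ 2))
    (Θ : Set (ML2R.E q)) (hΘcompact : IsCompact Θ) (hΘconvex : Convex ℝ Θ)
    (θ : ℕ → Ω' → ML2R.E q) (θ₀ : ML2R.E q) (hθ₀ : θ₀ ∈ Θ) (hθzero : ∀ ω, θ 0 ω = θ₀)
    (hθsucc : ∀ n ω, ML2R.IsProj Θ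
      (θ n ω - γ (n + 1) • A.G (variance (fun ω => A.P (XT ω)) μ) l (θ n ω)
        (fun t => W (n + 1) t ω)) (θ (n + 1) ω))
    (θstar : ML2R.E q)
    (hmin : IsMinOn (A.v μ B (variance (fun ω => A.P (XT ω)) μ) l) Θ θstar) (hθstar : θstar ∈ Θ) :
    ∀ᵐ ω ∂μ', Tendsto (fun n => θ n ω) atTop (𝓝 θstar) := by
  obtain ⟨κ, hκpos, hκ⟩ := ML2R.Setting.exists_weightedSq_eq hA hvar hl hW
  obtain ⟨V, hV⟩ := hSE
  have hZp := ML2R.Setting.memLp_Z hA hB.measurable hXT (by linarith) hV hZ₁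
  have hp' : 4 < ENNReal.ofReal p := by simpa [ENNReal.lt_ofReal_iff_toReal_lt] using hp
  obtain ⟨c, K, hc, hG⟩ := ML2R.Setting.exists_isMonotoneEstimator_G hA hB hκpos hκ hp' hZp hZ
    hΘcompact.isBounded hmin
  exact ML2R.ae_tendsto_of_projected_robbinsMonro hG hc hΘcompact.isClosed hΘconvex hθstar
    (fun n => measurable_pi_lambda _ (hWmeas (n + 1))) (fun n => (hWcopy (n + 1)).map_eq)
    (hWindep.precomp (add_left_injective 1)) (fun n => (hγpos (n + 1) n.succ_pos).le)
    hγsum hγsq hθ₀ hθzero hθsucc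

theorem theorem3 {d q : ℕ} (A : ML2R.Setting d q) (hA : A.Admissible)
    -- the Brownian motion `B` and the solution `X` of the stochastic differential equation
    {Ω : Type*} [mΩ : MeasurableSpace Ω] (μ : Measure Ω) [IsProbabilityMeasure μ]
    (ℱ : Filtration ℝ≥0 mΩ) (B : ℝ≥0 → Ω → ML2R.E q) (hB : ML2R.IsBrownianMotion μ ℱ B)
    (X : ℝ≥0 → Ω → ML2R.E d) (hX : ML2R.IsSDESolution μ ℱ A.b A.σ A.x₀ A.T B X)
    (varP : ℝ) (hvarP : varP = variance (fun ω => A.P (X A.T ω)) μ)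
    -- the level
    (l : ℕ) (hl : 1 ≤ l) (hlL : l ≤ A.L)
    -- the coefficients `k_l` are well defined and nonzero
    (hP : 1 < A.β → MemLp (fun ω => A.P (X A.T ω)) 2 μ ∧ 0 < varP)
    (hW : 1 < A.β → 2 ≤ l → A.bigW l ≠ 0)
    -- strong errors and integrability
    (hSE₂ : A.StrongError μ B (X A.T) 2 A.V₁)
    (p : ℝ) (hp : 4 < p) (hSE : ∃ V : ℝ, 0 < V ∧ A.StrongError μ B (X A.T) p V)
    (hZ₁ : l = 1 → MemLp (fun ω => A.Z 1 (fun t => B t ω)) (ENNReal.ofReal p) μ)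
    -- nondegeneracy
    (hZ : 0 < μ {ω | A.Z l (fun t => B t ω) ≠ 0})
    -- the independent copies of `B` that drive the algorithm
    {Ω' : Type*} [MeasurableSpace Ω'] (μ' : Measure Ω') [IsProbabilityMeasure μ']
    (W : ℕ → ℝ≥0 → Ω' → ML2R.E q) (hWmeas : ∀ n t, Measurable (W n t))
    (hWcopy : ∀ n, IdentDistrib (fun ω t => W n t ω) (fun ω t => B t ω) μ' μ)
    (hWindep : iIndepFun (fun n ω t => W n t ω) μ')
    -- the step sizes
    (γ : ℕ → ℝ) (hγpos : ∀ n, 1 ≤ n → 0 < γ n) (hγdec : ∀ n, 1 ≤ n → γ (n + 1) ≤ γ n)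
    (hγsum : ¬ Summable (fun n => γ (n + 1))) (hγsq : Summable (fun n => γ (n + 1) ^ 2))
    -- the constraint set and the projected Robbins-Monro iterates
    (Θ : Set (ML2R.E q)) (hΘcompact : IsCompact Θ) (hΘconvex : Convex ℝ Θ)
    (θ : ℕ → Ω' → ML2R.E q) (θ₀ : ML2R.E q) (hθ₀ : θ₀ ∈ Θ) (hθzero : ∀ ω, θ 0 ω = θ₀)
    (hθsucc : ∀ n ω, ML2R.IsProj Θ
      (θ n ω - γ (n + 1) • A.G varP l (θ n ω) (fun t => W (n + 1) t ω)) (θ (n + 1) ω))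
    -- the minimizer
    (θstar : ML2R.E q) (hmin : ∀ ϑ, A.v μ B varP l θstar ≤ A.v μ B varP l ϑ)
    (hgrad : HasGradientAt (A.v μ B varP l) 0 θstar) (hθstar : θstar ∈ Θ) :
    ∀ᵐ ω ∂μ', Tendsto (fun n => θ n ω) atTop (𝓝 θstar) := by
  subst hvarP
  exact theorem3_general A hA μ ℱ B hB (X A.T) ((hX.adapted A.T).mono (ℱ.le A.T)).measurable l hl
    (fun hβ => (hP hβ).2) hW p hp (hSE.imp fun _ => And.right) hZ₁ hZ μ' W hWmeas hWcopy hWindep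
    γ hγpos hγsum hγsq Θ hΘcompact hΘconvex θ θ₀ hθ₀ hθzero hθsucc θstar (fun ϑ _ => hmin ϑ) hθstar
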